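/- Let $F$ be a finite simple graph with chromatic number $\chi(F)=r+1\ge 3$. For a finite simple graph $G$, let $\lambda(G)$ denote its spectral radius, that is, the maximum absolute value of the eigenvalues of its adjacency matrix; $G$ is called $F$-free if it has no (not necessarily induced) subgraph isomorphic to $F$. Then for every $F$-free graph $G$ with $m$ edges, $$\lambda^2(G)\le\Bigl(1-\frac1r+o(1)\Bigr)2m,$$ where, for fixed $F$, the term $o(1)$ tends to $0$ as $m\to\infty$, uniformly over all $F$-free graphs $G$ with $m$ edges. In other words, for every $\varepsilon>0$ there is an integer $m_0=m_0(F,\varepsilon)$ such that every $F$-free graph $G$ with $m\ge m_0$ edges satisfies $$\lambda^2(G)\le\Bigl(1-\frac1r+\varepsilon\Bigr)2m.$$ -/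

import Mathlib

/-- The spectral radius of a finite simple graph: the maximum absolute value of the
eigenvalues of its (real) adjacency matrix. The matrix has finitely many eigenvalues, so
the extended nonnegative supremum is finite, and it is `0` for the graph without vertices. -/
noncomputable def graphSpectralRadius {V : Type*} [Fintype V] [DecidableEq V]
    (G : SimpleGraph V) [DecidableRel G.Adj] : ℝ :=
  (spectralRadius ℝ (G.adjMatrix ℝ)).toReal

/-! Let `M = √m` and let `x` be the entrywise absolute value of a unit eigenvector. Edges with `x i
* x j` far from `1 / M` add little to the adjacency form, so by Cauchy–Schwarz `k ^ 2 / (2 * m)` is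
nearly at most the probability `D` that two independent vertices drawn from `x ^ 2` span a balanced
edge (`sq_le_density_balancedSubgraph`). If `D` exceeds `1 - 1 / r`, some bounded sample is dense
enough for Erdős–Stone to give a complete equipartite graph in the pullback. The sample may repeat
vertices, but only ones too heavy to lie in a balanced triangle. Every vertex of the equipartite
graph lies in a triangle, so its copy avoids the repeats and maps injectively into `G`. -/

/-! ### Eigenvalues and the adjacency form -/

/-- A quadratic bound for all eigenvalues of the adjacency matrix bounds the spectral radius. -/
theorem graphSpectralRadius_sq_le {V : Type*} [Fintype V] [DecidableEq V]
    (G : SimpleGraph V) [DecidableRel G.Adj] {B : ℝ} (hB : 0 ≤ B)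
    (h : ∀ k ∈ spectrum ℝ (G.adjMatrix ℝ), k ^ 2 ≤ B) :
    graphSpectralRadius G ^ 2 ≤ B := by
  have h1 : spectralRadius ℝ (G.adjMatrix ℝ) ≤ ENNReal.ofReal (Real.sqrt B) := by
    refine iSup₂_le fun k hk => ?_
    change ‖k‖ₑ ≤ _
    rw [← ofReal_norm]
    exact ENNReal.ofReal_le_ofReal (Real.abs_le_sqrt (h k hk))
  have h2 : graphSpectralRadius G ≤ Real.sqrt B :=
    ENNReal.toReal_le_of_le_ofReal (Real.sqrt_nonneg B) h1
  calc graphSpectralRadius G ^ 2 ≤ Real.sqrt B ^ 2 :=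
        pow_le_pow_left₀ ENNReal.toReal_nonneg h2 2
    _ = B := Real.sq_sqrt hB

open Finset in
/-- The absolute value of an eigenvalue of the adjacency matrix is at most the value of the
adjacency form at a nonnegative unit vector. -/
theorem exists_abs_eigenvalue_le_sum_adj {V : Type*} [Fintype V] [DecidableEq V]
    (G : SimpleGraph V) [DecidableRel G.Adj] {k : ℝ}
    (hk : k ∈ spectrum ℝ (G.adjMatrix ℝ)) :
    ∃ x : V → ℝ, (∀ i, 0 ≤ x i) ∧ ∑ i, x i ^ 2 = 1 ∧
      |k| ≤ ∑ p : V × V with G.Adj p.1 p.2, x p.1 * x p.2 := by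
  rw [← Matrix.spectrum_toLin', ← Module.End.hasEigenvalue_iff_mem_spectrum] at hk
  obtain ⟨v, hv⟩ := hk.exists_hasEigenvector
  have hkv : ∀ i, k * v i = ∑ j, if G.Adj i j then v j else 0 := by
    intro i
    have := congrFun hv.apply_eq_smul i
    simpa [Matrix.toLin'_apply, Matrix.mulVec, dotProduct, SimpleGraph.adjMatrix_apply,
      eq_comm, sum_filter] using this
  set s : ℝ := ∑ i, v i ^ 2 with hs
  have hs0 : 0 < s := by
    obtain ⟨i, hi⟩ := Function.ne_iff.mp hv.2
    exact sum_pos' (fun i _ => sq_nonneg (v i)) ⟨i, mem_univ i, by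
      simpa using pow_pos (abs_pos.2 hi) 2⟩
  refine ⟨fun i => |v i| / √s, fun i => by positivity, ?_, ?_⟩
  · simp_rw [div_pow, Real.sq_sqrt hs0.le, sq_abs, ← sum_div]
    exact div_self hs0.ne'
  · have h1 : k * s = ∑ p : V × V with G.Adj p.1 p.2, v p.1 * v p.2 := by
      rw [sum_filter, Fintype.sum_prod_type, hs, mul_sum]
      refine sum_congr rfl fun i _ => ?_
      rw [show k * v i ^ 2 = v i * (k * v i) by ring, hkv i, mul_sum]
      simp
    have h2 : |k| * s ≤ ∑ p : V × V with G.Adj p.1 p.2, |v p.1| * |v p.2| := by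
      rw [show |k| * s = |k * s| by rw [abs_mul, abs_of_pos hs0], h1]
      refine (abs_sum_le_sum_abs _ _).trans_eq ?_
      simp_rw [abs_mul]
    simp_rw [div_mul_div_comm, Real.mul_self_sqrt hs0.le, ← sum_div]
    exact (le_div_iff₀ hs0).2 h2

/-! ### Balanced edges -/

/-- The edges of `G` along which the product of the weights `x` is within a factor `K`
of `1 / M`. -/
def balancedSubgraph {V : Type*} (G : SimpleGraph V) (x : V → ℝ) (K M : ℝ) : SimpleGraph V where
  Adj i j := G.Adj i j ∧ 1 / K ≤ x i * x j * M ∧ x i * x j * M ≤ K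
  symm := ⟨fun i j h => ⟨h.1.symm, by rw [mul_comm (x j)]; exact h.2⟩⟩
  loopless := ⟨fun i h => G.loopless.irrefl i h.1⟩

theorem balancedSubgraph_le {V : Type*} (G : SimpleGraph V) (x : V → ℝ) (K M : ℝ) :
    balancedSubgraph G x K M ≤ G :=
  fun _ _ h => h.1

/-- A vertex in a triangle of the balanced subgraph has small weight. -/
theorem sq_le_of_balancedSubgraph_triangle {V : Type*} {G : SimpleGraph V} {x : V → ℝ} {K M : ℝ}
    (hK : 0 < K) (hM : 0 < M) {i j k : V} (hij : (balancedSubgraph G x K M).Adj i j)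
    (hik : (balancedSubgraph G x K M).Adj i k) (hjk : (balancedSubgraph G x K M).Adj j k) :
    x i ^ 2 ≤ K ^ 3 / M := by
  obtain ⟨-, hij1, hij2⟩ := hij
  obtain ⟨-, hik1, hik2⟩ := hik
  obtain ⟨-, hjk1, -⟩ := hjk
  have h0 : 0 < 1 / K := by positivity
  -- `x i ^ 2 * M` is the product of the scaled weights of `ij` and `ik` over that of `jk`, hence at
  -- most `K * K / (1 / K)`.
  have h1 : (x i * x j * M) * (x i * x k * M) ≤ K * K :=
    mul_le_mul hij2 hik2 (h0.le.trans hik1) hK.le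
  have h2 : x i ^ 2 * M * (1 / K) ≤ x i ^ 2 * M * (x j * x k * M) :=
    mul_le_mul_of_nonneg_left hjk1 (by positivity)
  have h3 : x i ^ 2 * M * (1 / K) ≤ K * K := by linarith
  rw [le_div_iff₀ hM]
  rw [mul_one_div, div_le_iff₀ hK] at h3
  linarith

open Finset in
theorem card_filter_adj_prod {V : Type*} [Fintype V]
    (G : SimpleGraph V) [DecidableRel G.Adj] :
    #{p : V × V | G.Adj p.1 p.2} = 2 * #G.edgeFinset := by
  rw [← G.sum_degrees_eq_twice_card_edges, card_filter, Fintype.sum_prod_type]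
  refine sum_congr rfl fun i _ => ?_
  rw [← card_filter, ← G.card_neighborFinset_eq_degree, G.neighborFinset_eq_filter]

open Finset in
theorem sum_prod_sq_mul_sq {V : Type*} [Fintype V] {x : V → ℝ} (hx1 : ∑ i, x i ^ 2 = 1) :
    ∑ p : V × V, x p.1 ^ 2 * x p.2 ^ 2 = 1 := by
  rw [Fintype.sum_prod_type]
  simp [← mul_sum, hx1]

open Finset Classical in
/-- The square of the adjacency form of a unit vector `x` is controlled by the density of the
balanced subgraph with respect to the distribution `x ^ 2`. -/
theorem sq_le_density_balancedSubgraph {V : Type*} [Fintype V]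
    (G : SimpleGraph V) {x : V → ℝ} (hx : ∀ i, 0 ≤ x i) (hx1 : ∑ i, x i ^ 2 = 1)
    {K M : ℝ} (hK : 1 ≤ K) (hM : 0 < M) (hMG : M ^ 2 = #G.edgeFinset) {c : ℝ} (hc : 0 ≤ c)
    (h : c ≤ ∑ p : V × V with G.Adj p.1 p.2, x p.1 * x p.2) :
    c ^ 2 ≤ 2 * M ^ 2 * (∑ p : V × V with (balancedSubgraph G x K M).Adj p.1 p.2,
      x p.1 ^ 2 * x p.2 ^ 2 + 10 / K) := by
  have hK0 : 0 < K := by linarith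
  set G' := balancedSubgraph G x K M
  set E : Finset (V × V) := {p : V × V | G.Adj p.1 p.2} with hE
  set E' : Finset (V × V) := {p : V × V | G'.Adj p.1 p.2} with hE'
  set w : V × V → ℝ := fun p => x p.1 * x p.2 with hw
  have hw0 : ∀ p, 0 ≤ w p := fun p => mul_nonneg (hx _) (hx _)
  have hsub : E' ⊆ E := fun p hp => by
    simp only [hE, hE', mem_filter, mem_univ, true_and] at hp ⊢
    exact balancedSubgraph_le G x K M hp
  have hcard : (#E : ℝ) = 2 * M ^ 2 := by
    have h1 : #E = 2 * #G.edgeFinset := by rw [← card_filter_adj_prod G]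
    rw [hMG, h1]; push_cast; rfl
  have hcard' : (#E' : ℝ) ≤ 2 * M ^ 2 := hcard ▸ by exact_mod_cast card_le_card hsub
  have hw2 : ∀ p, x p.1 ^ 2 * x p.2 ^ 2 = w p ^ 2 := fun p => by simp only [hw]; ring
  have htot : ∑ p, w p ^ 2 = 1 := by simp_rw [← hw2]; exact sum_prod_sq_mul_sq hx1
  simp_rw [hw2]
  set D := ∑ p ∈ E', w p ^ 2
  set S := ∑ p ∈ E', w p with hS
  have hS0 : 0 ≤ S := sum_nonneg fun p _ => hw0 p
  have hD1 : D ≤ 1 := htot ▸ sum_le_univ_sum_of_nonneg fun p => sq_nonneg _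
  have hD0 : 0 ≤ D := sum_nonneg fun p _ => sq_nonneg _
  have hSD : S ^ 2 ≤ 2 * M ^ 2 * D :=
    (sq_sum_le_card_mul_sum_sq (s := E') (f := w)).trans
      (mul_le_mul_of_nonneg_right hcard' hD0)
  -- An unbalanced edge has either `w p < 1 / (K * M)` or `1 < w p * M / K`; multiplying the latter
  -- by `w p` gives the quadratic term.
  have hpt : ∀ p ∈ E, w p ≤ (if p ∈ E' then w p else 0) + (1 / (K * M) + w p ^ 2 * (M / K)) := by
    intro p hp
    split_ifs with hp'
    · have : 0 ≤ 1 / (K * M) + w p ^ 2 * (M / K) := by positivity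
      linarith
    · have h1 : ¬ (1 / K ≤ w p * M ∧ w p * M ≤ K) := fun hh => hp' (by
        simp only [hE, hE', mem_filter, mem_univ, true_and] at hp ⊢
        exact ⟨hp, hh⟩)
      rw [not_and_or, not_le, not_le] at h1
      have e1 : 0 ≤ w p ^ 2 * (M / K) := by positivity
      have e2 : 0 ≤ 1 / (K * M) := by positivity
      rcases h1 with h1 | h1
      · have : w p ≤ 1 / (K * M) := by
          rw [← div_div, le_div_iff₀ hM]; exact h1.le
        linarith
      · have : w p ≤ w p ^ 2 * (M / K) := by
          rw [← mul_div_assoc, le_div_iff₀ hK0]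
          nlinarith [mul_le_mul_of_nonneg_left h1.le (hw0 p)]
        linarith
  have hcS : c ≤ S + 3 * M / K := by
    have h1 := h.trans (sum_le_sum hpt)
    rw [sum_add_distrib, sum_add_distrib, sum_const, nsmul_eq_mul, hcard, ← sum_mul,
      sum_ite_mem, inter_eq_right.2 hsub, ← hS] at h1
    have h2 : (∑ p ∈ E, w p ^ 2) * (M / K) ≤ 1 * (M / K) :=
      mul_le_mul_of_nonneg_right (htot ▸ sum_le_univ_sum_of_nonneg fun p => sq_nonneg _)
        (by positivity)
    have h3 : 2 * M ^ 2 * (1 / (K * M)) = 2 * (M / K) := by field_simp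
    rw [h3] at h1
    rw [mul_div_assoc]
    linarith
  have hSM : S ≤ 3 / 2 * M := by
    refine le_of_sq_le_sq ?_ (by positivity)
    nlinarith [mul_le_mul_of_nonneg_left hD1 (sq_nonneg M)]
  have hc2 : c ^ 2 ≤ (S + 3 * M / K) ^ 2 := pow_le_pow_left₀ hc hcS 2
  have hinv : 1 / K ≤ 1 := by rw [div_le_one hK0]; exact hK
  have hinv0 : 0 ≤ 1 / K := by positivity
  have e3 : 3 * M / K = 3 * M * (1 / K) := by ring
  have e4 : (10 : ℝ) / K = 10 * (1 / K) := by ring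
  rw [e3] at hc2
  rw [e4]
  -- In units of `M ^ 2 / K`, the cross term costs at most 9 and the square at most 9, within the 20
  -- allowed.
  generalize 1 / K = u at *
  have a1 : S * (M * u) ≤ 3 / 2 * M * (M * u) := mul_le_mul_of_nonneg_right hSM (by positivity)
  have a2 : M ^ 2 * u * u ≤ M ^ 2 * u * 1 := mul_le_mul_of_nonneg_left hinv (by positivity)
  nlinarith [mul_nonneg (sq_nonneg M) hinv0]

/-! ### Turán density from the minimum-degree Erdős–Stone theorem -/

open Finset Filter SimpleGraph in
/-- **Erdős–Stone theorem**, in terms of the Turán density. -/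
theorem turanDensity_completeEquipartiteGraph_le {r t : ℕ} (hr : 1 ≤ r) (ht : 1 ≤ t) :
    turanDensity (completeEquipartiteGraph (r + 1) t) ≤ 1 - 1 / (r : ℝ) := by
  set H := completeEquipartiteGraph (r + 1) t with hH
  have hbot : H ≠ ⊥ := by
    rw [Ne, hH, completeEquipartiteGraph_eq_bot_iff]; omega
  refine le_of_forall_pos_le_add fun ε hε => ?_
  set a : ℝ := 1 - 1 / (r : ℝ) + ε with ha
  obtain ⟨N, hN⟩ := eventually_atTop.1
    (eventually_completeEquipartiteGraph_isContained_of_minDegree hε r t)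
  -- Delete a vertex of minimum degree from an extremal graph: being `H`-free, it has minimum degree
  -- below `a * (n + 1)`.
  have hstep : ∀ n, N ≤ n → (extremalNumber (n + 1) H : ℝ) ≤ extremalNumber n H + a * (n + 1) := by
    intro n hn
    obtain ⟨G, _, hG⟩ := exists_isExtremal_free (V := Fin (n + 1)) hbot
    have hlt : (G.minDegree : ℝ) < a * ((n + 1 : ℕ) : ℝ) := by
      by_contra! hge
      exact hG.prop (hN (n + 1) (by omega) hge)
    obtain ⟨v, hv⟩ := G.exists_minimal_degree_vertex
    have h1 := card_edgeFinset_deleteIncidenceSet_le_extremalNumber hG.prop v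
    rw [card_edgeFinset_deleteIncidenceSet, card_edgeFinset_of_isExtremal_free hG, ← hv,
      Fintype.card_fin, Nat.add_sub_cancel, Nat.sub_le_iff_le_add] at h1
    have h2 : (extremalNumber (n + 1) H : ℝ) ≤ extremalNumber n H + G.minDegree := by
      exact_mod_cast h1
    push_cast at hlt
    linarith
  have hsum : ∀ n, N ≤ n → (extremalNumber n H : ℝ) ≤
      extremalNumber N H + a * ((n * (n + 1) - N * (N + 1)) / 2) := by
    intro n hn
    induction n, hn using Nat.le_induction with
    | base => simp
    | succ n hn ih =>
      have := hstep n hn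
      push_cast
      linarith
  have hlim := tendsto_turanDensity H
  set C : ℝ := extremalNumber N H - a * (N * (N + 1) / 2) with hC
  have hbound : ∀ᶠ n : ℕ in atTop, (extremalNumber n H / n.choose 2 : ℝ) ≤
      a + 2 * a * ((n : ℝ) - 1)⁻¹ + C * (2 * ((n : ℝ)⁻¹ * ((n : ℝ) - 1)⁻¹)) := by
    filter_upwards [eventually_ge_atTop N, eventually_ge_atTop 2] with n hn h2
    have h2' : (2 : ℝ) ≤ n := by exact_mod_cast h2
    have hn0 : (n : ℝ) ≠ 0 := by linarith
    have hn1 : (n : ℝ) - 1 ≠ 0 := by linarith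
    rw [Nat.cast_choose_two, div_le_iff₀ (by nlinarith)]
    refine (hsum n hn).trans_eq ?_
    rw [hC]
    field_simp
    ring
  have hinv : Tendsto (fun n : ℕ => (n : ℝ)⁻¹) atTop (nhds 0) := tendsto_inv_atTop_nhds_zero_nat
  have hinv1 : Tendsto (fun n : ℕ => ((n : ℝ) - 1)⁻¹) atTop (nhds 0) :=
    tendsto_inv_atTop_zero.comp
      (tendsto_atTop_add_const_right _ (-1) tendsto_natCast_atTop_atTop)
  have hlim2 : Tendsto (fun n : ℕ => a + 2 * a * ((n : ℝ) - 1)⁻¹ +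
      C * (2 * ((n : ℝ)⁻¹ * ((n : ℝ) - 1)⁻¹))) atTop (nhds a) := by
    simpa using (tendsto_const_nhds.add (hinv1.const_mul (2 * a))).add
      (((hinv.mul hinv1).const_mul 2).const_mul C)
  exact le_of_tendsto_of_tendsto hlim hlim2 hbound

/-! ### Random sampling of vertices -/

open Finset in
theorem sum_prod_eq_one {ι V : Type*} [Fintype ι] [DecidableEq ι] [Fintype V] {y : V → ℝ}
    (hy : ∑ v, y v = 1) : ∑ f : ι → V, ∏ k, y (f k) = 1 := by
  have := (Finset.prod_univ_sum (fun _ : ι => (univ : Finset V)) fun _ v => y v)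
  simp only [hy, prod_const_one, Fintype.piFinset_univ] at this
  exact this.symm

open Finset in
/-- Two coordinates of an i.i.d. sample are independent with the given distribution. -/
theorem sum_prod_mul_pair {ι V : Type*} [Fintype ι] [DecidableEq ι] [Fintype V] [DecidableEq V]
    {y : V → ℝ} (hy : ∑ v, y v = 1) (g : V → V → ℝ) {i j : ι} (hij : i ≠ j) :
    ∑ f : ι → V, (∏ k, y (f k)) * g (f i) (f j) = ∑ p : V × V, y p.1 * y p.2 * g p.1 p.2 := by
  have key : ∀ a b : V, ∑ f : ι → V, (∏ k, y (f k)) *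
      ((if f i = a then 1 else 0) * (if f j = b then 1 else 0)) = y a * y b := by
    intro a b
    -- Indicators are absorbed into one factor per coordinate, so the sum factorizes; coordinates
    -- other than `i`, `j` contribute 1.
    set h : ι → V → ℝ := fun k v => y v *
      ((if k = i then (if v = a then 1 else 0) else 1) *
       (if k = j then (if v = b then 1 else 0) else 1)) with hh
    have h1 : ∀ f : ι → V, (∏ k, y (f k)) *
        ((if f i = a then 1 else 0) * (if f j = b then 1 else 0)) = ∏ k, h k (f k) := by
      intro f
      simp only [hh, prod_mul_distrib, prod_ite_eq', mem_univ, if_true]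
    have h2 := (Finset.prod_univ_sum (fun _ : ι => (univ : Finset V)) h)
    rw [Fintype.piFinset_univ] at h2
    simp_rw [h1]
    rw [← h2, ← mul_prod_erase univ _ (mem_univ i),
      ← mul_prod_erase (univ.erase i) _ (mem_erase.2 ⟨hij.symm, mem_univ j⟩),
      prod_eq_one (s := (univ.erase i).erase j)]
    · simp [hh, hij, hij.symm]
    · intro k hk
      simp only [mem_erase, mem_univ, and_true] at hk
      simp [hh, hk.1, hk.2, hy]
  have h3 : ∀ f : ι → V, g (f i) (f j) = ∑ p : V × V,
      ((if f i = p.1 then 1 else 0) * (if f j = p.2 then 1 else 0)) * g p.1 p.2 := by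
    intro f
    rw [Fintype.sum_prod_type]
    simp
  simp_rw [h3, mul_sum]
  rw [sum_comm]
  refine sum_congr rfl fun p _ => ?_
  rw [← key p.1 p.2, sum_mul]
  exact sum_congr rfl fun f _ => by ring

open Finset Classical in
/-- A sample of `n` vertices from the distribution `y` that is about as dense as the whole graph
and has no repeated vertex of weight at most `δ`. -/
theorem exists_dense_sample {V : Type*} [Fintype V] (G : SimpleGraph V) {y : V → ℝ}
    (hy0 : ∀ v, 0 ≤ y v) (hy : ∑ v, y v = 1) {n : ℕ} (hn : 1 ≤ n) {δ b : ℝ} (hδ : 0 ≤ δ)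
    (hb0 : 0 ≤ b)
    (hb : b ≤ (n * (n - 1) : ℝ) *
      ∑ p : V × V with G.Adj p.1 p.2, y p.1 * y p.2 - (n : ℝ) ^ 4 * δ) :
    ∃ f : Fin n → V, (∀ i j, i ≠ j → f i = f j → δ < y (f i)) ∧
      b ≤ 2 * #(G.comap f).edgeFinset := by
  set Q : Finset (Fin n × Fin n) := {q | q.1 ≠ q.2} with hQ
  have hQcard : #Q = n * n - n := by
    have : Q = (univ : Finset (Fin n)).offDiag := by ext q; simp [hQ]
    rw [this, offDiag_card]; simp
  have hQcard' : (#Q : ℝ) = n * (n - 1) := by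
    rw [hQcard, Nat.cast_sub (Nat.le_mul_self n)]; push_cast; ring
  -- The penalty `n ^ 2` exceeds the number `n * (n - 1)` of ordered pairs, so a single light repeat
  -- would make the total negative, against `0 ≤ b`.
  set g : V → V → ℝ := fun u v =>
    (if G.Adj u v then 1 else 0) - n ^ 2 * (if u = v ∧ y u ≤ δ then 1 else 0) with hg
  set D := ∑ p : V × V with G.Adj p.1 p.2, y p.1 * y p.2 with hD
  have hdiag : ∑ p : V × V, y p.1 * y p.2 * (if p.1 = p.2 ∧ y p.1 ≤ δ then 1 else 0) ≤ δ := by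
    rw [Fintype.sum_prod_type]
    calc _ ≤ ∑ u, y u * δ := by
          refine sum_le_sum fun u _ => ?_
          rw [sum_eq_single u (by intro v _ hv; simp [hv.symm]) (by simp)]
          have := hy0 u
          by_cases h : y u ≤ δ
          · simp only [h, and_self, if_true, mul_one]; gcongr
          · simp only [h, and_false, if_false, mul_zero]; positivity
      _ = δ := by rw [← sum_mul, hy, one_mul]
  have hpair : ∑ p : V × V, y p.1 * y p.2 * g p.1 p.2 ≥ D - n ^ 2 * δ := by
    have h1 : ∑ p : V × V, y p.1 * y p.2 * g p.1 p.2 = D - n ^ 2 *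
        ∑ p : V × V, y p.1 * y p.2 * (if p.1 = p.2 ∧ y p.1 ≤ δ then 1 else 0) := by
      rw [hD, sum_filter, mul_sum, ← sum_sub_distrib]
      refine sum_congr rfl fun p _ => ?_
      simp only [hg]
      split_ifs <;> ring
    rw [h1]
    gcongr
  have hmean : b ≤ ∑ f : Fin n → V, (∏ k, y (f k)) * ∑ q ∈ Q, g (f q.1) (f q.2) := by
    simp_rw [mul_sum]
    rw [sum_comm]
    have h1 : ∀ q ∈ Q, D - n ^ 2 * δ ≤
        ∑ f : Fin n → V, (∏ k, y (f k)) * g (f q.1) (f q.2) := by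
      intro q hq
      rw [sum_prod_mul_pair hy g (by simpa [hQ] using hq)]
      exact hpair
    refine le_trans ?_ (sum_le_sum h1)
    rw [sum_const, nsmul_eq_mul, hQcard']
    have hn' : (1 : ℝ) ≤ n := by exact_mod_cast hn
    have : (n : ℝ) * (n - 1) * (n ^ 2 * δ) ≤ n * n * (n ^ 2 * δ) := by
      gcongr; linarith
    nlinarith
  obtain ⟨f, hf⟩ : ∃ f : Fin n → V, b ≤ ∑ q ∈ Q, g (f q.1) (f q.2) := by
    by_contra! hlt
    have hle : ∑ f : Fin n → V, (∏ k, y (f k)) * ∑ q ∈ Q, g (f q.1) (f q.2) <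
        ∑ f : Fin n → V, (∏ k, y (f k)) * b := by
      have hnn : ∀ f : Fin n → V, 0 ≤ ∏ k, y (f k) := fun f => prod_nonneg fun k _ => hy0 _
      refine sum_lt_sum (fun f _ => mul_le_mul_of_nonneg_left (hlt f).le (hnn f)) ?_
      by_contra! hall
      have hzero : ∀ f : Fin n → V, ∏ k, y (f k) = 0 := fun f => by
        by_contra hne
        exact absurd (hall f (mem_univ f)) (not_le.2
          (mul_lt_mul_of_pos_left (hlt f) (lt_of_le_of_ne (hnn f) (Ne.symm hne))))
      have := sum_prod_eq_one (ι := Fin n) hy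
      simp [hzero] at this
    rw [← sum_mul, sum_prod_eq_one hy, one_mul] at hle
    exact absurd hmean (not_le.2 hle)
  have hadj : ∑ q ∈ Q, (if G.Adj (f q.1) (f q.2) then (1 : ℝ) else 0) =
      2 * #(G.comap f).edgeFinset := by
    have h1 := card_filter_adj_prod (G.comap f)
    rw [← Nat.cast_two, ← Nat.cast_mul, ← h1, sum_boole]
    congr 2
    ext q
    simp only [hQ, mem_filter, mem_univ, true_and, SimpleGraph.comap_adj, and_iff_right_iff_imp]
    rintro h heq
    exact G.ne_of_adj h (by rw [heq])
  have hsplit : ∑ q ∈ Q, g (f q.1) (f q.2) = 2 * #(G.comap f).edgeFinset - n ^ 2 *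
      ∑ q ∈ Q, (if f q.1 = f q.2 ∧ y (f q.1) ≤ δ then (1 : ℝ) else 0) := by
    simp only [hg, sum_sub_distrib, hadj, mul_sum]
  have hbad0 : 0 ≤ ∑ q ∈ Q, (if f q.1 = f q.2 ∧ y (f q.1) ≤ δ then (1 : ℝ) else 0) :=
    sum_nonneg fun q _ => by split_ifs <;> norm_num
  have hn' : (1 : ℝ) ≤ n := by exact_mod_cast hn
  refine ⟨f, fun i j hij hfij => ?_, ?_⟩
  · by_contra! hle
    have h1 : 1 ≤ ∑ q ∈ Q, (if f q.1 = f q.2 ∧ y (f q.1) ≤ δ then (1 : ℝ) else 0) := by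
      have hmem : (i, j) ∈ Q := by simpa [hQ] using hij
      refine le_trans ?_ (single_le_sum
        (f := fun q : Fin n × Fin n => if f q.1 = f q.2 ∧ y (f q.1) ≤ δ then (1 : ℝ) else 0)
        (fun q _ => by split_ifs <;> norm_num) hmem)
      simp [hfij, hfij ▸ hle]
    have h2 : (2 * #(G.comap f).edgeFinset : ℝ) ≤ n * (n - 1) := by
      rw [← hadj, ← hQcard', ← nsmul_one, ← sum_const]
      exact sum_le_sum fun q _ => by split_ifs <;> norm_num
    rw [hsplit] at hf
    nlinarith [mul_le_mul_of_nonneg_left h1 (sq_nonneg (n : ℝ))]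
  · rw [hsplit] at hf
    have := mul_nonneg (sq_nonneg (n : ℝ)) hbad0
    linarith

/-! ### From the pullback to the graph -/

open SimpleGraph in
/-- If every vertex of `H` lies in a triangle and `f` only identifies vertices whose image is in
no triangle of `G`, then a copy of `H` in the pullback of `G` along `f` gives a copy in `G`. -/
theorem SimpleGraph.IsContained.of_comap {α β V : Type*} {H : SimpleGraph α} {G : SimpleGraph V}
    {f : β → V} (h : H ⊑ G.comap f) (hH : ∀ a, ∃ b c, H.Adj a b ∧ H.Adj a c ∧ H.Adj b c)
    (hf : ∀ i j, i ≠ j → f i = f j →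
      ∀ u v, G.Adj (f i) u → G.Adj (f i) v → ¬ G.Adj u v) : H ⊑ G := by
  obtain ⟨φ⟩ := h
  have hadj : ∀ {a b}, H.Adj a b → G.Adj (f (φ a)) (f (φ b)) := fun hab => φ.toHom.map_adj hab
  refine ⟨⟨⟨fun a => f (φ a), hadj⟩, fun a a' haa' => ?_⟩⟩
  by_contra hne
  obtain ⟨b, c, hab, hac, hbc⟩ := hH a
  exact hf (φ a) (φ a') (φ.injective.ne hne) haa' _ _ (hadj hab) (hadj hac) (hadj hbc)

/-- Chromatic number at least 3 is essential here: with two parts there are no triangles. -/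
theorem exists_triangle_completeEquipartiteGraph {r t : ℕ} (hr : 3 ≤ r + 1)
    (a : Fin (r + 1) × Fin t) : ∃ b c, (SimpleGraph.completeEquipartiteGraph (r + 1) t).Adj a b ∧
      (SimpleGraph.completeEquipartiteGraph (r + 1) t).Adj a c ∧
      (SimpleGraph.completeEquipartiteGraph (r + 1) t).Adj b c := by
  obtain ⟨b, hb⟩ := Finset.exists_mem_notMem_of_card_lt_card
    (s := {a.1}) (t := (Finset.univ : Finset (Fin (r + 1)))) (by simp; omega)
  obtain ⟨c, hc⟩ := Finset.exists_mem_notMem_of_card_lt_card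
    (s := {a.1, b}) (t := (Finset.univ : Finset (Fin (r + 1))))
    ((Finset.card_le_two).trans_lt (by simp; omega))
  simp only [Finset.mem_univ, Finset.mem_singleton, Finset.mem_insert, not_or, true_and] at hb hc
  refine ⟨(b, a.2), (c, a.2), ?_, ?_, ?_⟩ <;>
    simp only [SimpleGraph.completeEquipartiteGraph_adj]
  · exact Ne.symm hb
  · exact Ne.symm hc.1
  · exact Ne.symm hc.2

/-! ### Choice of constants and conclusion -/

open Finset SimpleGraph in
/-- An `F`-free graph with many edges has only eigenvalues `k` with
`k ^ 2 ≤ (1 - 1 / r + ε) * 2m`. -/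
theorem exists_forall_eigenvalue_sq_le {r t : ℕ} (hr : 3 ≤ r + 1) (ht : 1 ≤ t)
    {ε : ℝ} (hε : 0 < ε) :
    ∃ m₀ : ℕ, ∀ {V : Type*} [Fintype V] [DecidableEq V] (G : SimpleGraph V)
      [DecidableRel G.Adj], (SimpleGraph.completeEquipartiteGraph (r + 1) t).Free G →
        m₀ ≤ #G.edgeFinset → ∀ k ∈ spectrum ℝ (G.adjMatrix ℝ),
          k ^ 2 ≤ (1 - 1 / (r : ℝ) + ε) * (2 * (#G.edgeFinset : ℝ)) := by
  classical
  set H := SimpleGraph.completeEquipartiteGraph (r + 1) t with hH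
  obtain ⟨n₀, hn₀⟩ := Filter.eventually_atTop.1
    (SimpleGraph.eventually_isContained_of_card_edgeFinset H (show 0 < ε / 4 by linarith))
  set n := max n₀ 2 with hn
  have hn2 : 2 ≤ n := le_max_right _ _
  have hn2' : (2 : ℝ) ≤ n := by exact_mod_cast hn2
  set K : ℝ := max 1 (40 / ε) with hK
  have hK1 : 1 ≤ K := le_max_left _ _
  have hK0 : 0 < K := by linarith
  have hKε : 10 / K ≤ ε / 4 := by
    have : 40 / ε ≤ K := le_max_right _ _
    rw [div_le_iff₀ hε] at this
    rw [div_le_iff₀ hK0]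
    linarith
  have hr2 : (2 : ℝ) ≤ r := by exact_mod_cast (by omega : 2 ≤ r)
  have hrinv : 1 / (r : ℝ) ≤ 1 := by rw [div_le_one (by linarith)]; linarith
  -- This bound makes the repeat penalty `n ^ 4 * (K ^ 3 / M)` at most `ε`; the `+ 1` ensures `0 <
  -- M`.
  refine ⟨⌈((n : ℝ) ^ 4 * K ^ 3 / ε) ^ 2⌉₊ + 1, fun {V} _ _ G _ hfree hm k hk => ?_⟩
  by_contra! hlt
  set M : ℝ := √(#G.edgeFinset : ℝ) with hM
  have hm0 : (0 : ℝ) < #G.edgeFinset := by exact_mod_cast (by omega : 0 < #G.edgeFinset)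
  have hM0 : 0 < M := Real.sqrt_pos.2 hm0
  have hM2 : M ^ 2 = #G.edgeFinset := Real.sq_sqrt hm0.le
  have hMbig : (n : ℝ) ^ 4 * K ^ 3 / ε ≤ M := by
    refine Real.le_sqrt_of_sq_le ((Nat.le_ceil _).trans ?_)
    exact Nat.cast_le.2 (by omega)
  obtain ⟨x, hx0, hx1, hkx⟩ := exists_abs_eigenvalue_le_sum_adj G hk
  have hdens := sq_le_density_balancedSubgraph G hx0 hx1 hK1 hM0 (by convert hM2)
    (abs_nonneg k) (by convert hkx)
  set G' := balancedSubgraph G x K M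
  set D := ∑ p : V × V with G'.Adj p.1 p.2, x p.1 ^ 2 * x p.2 ^ 2
  have hD : 1 - 1 / (r : ℝ) + 3 * ε / 4 ≤ D := by
    rw [sq_abs, hM2] at hdens
    have h1 := hlt.trans_le hdens
    rw [mul_comm] at h1
    have := lt_of_mul_lt_mul_left h1 (by positivity)
    linarith
  -- Since `2 ≤ n * (n - 1)`, the penalty costs at most `ε / 2` of density, leaving `ε / 4` of the
  -- `3 * ε / 4` for Erdős–Stone.
  obtain ⟨f, hf, hedges⟩ := exists_dense_sample G' (fun v => sq_nonneg (x v)) hx1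
    (n := n) (by omega) (δ := K ^ 3 / M) (b := (1 - 1 / (r : ℝ) + ε / 4) * (n * (n - 1)))
    (by positivity) (mul_nonneg (by linarith) (mul_nonneg (by linarith) (by linarith))) (by
      have h1 : (n : ℝ) ^ 4 * (K ^ 3 / M) ≤ ε := by
        rw [← mul_div_assoc, div_le_iff₀ hM0]
        rw [div_le_iff₀ hε] at hMbig
        linarith
      have h2 : (2 : ℝ) ≤ n * (n - 1) := by nlinarith
      have h3 := mul_le_mul_of_nonneg_left hD (by linarith : (0 : ℝ) ≤ n * (n - 1))
      have h4 := mul_le_mul_of_nonneg_right h2 hε.le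
      nlinarith)
  have hcont : H ⊑ G'.comap f := by
    refine hn₀ n (le_max_left _ _) (G := G'.comap f) ?_
    have h1 := turanDensity_completeEquipartiteGraph_le (r := r) (by omega) ht
    rw [Nat.cast_choose_two, ge_iff_le]
    have h2 := mul_le_mul_of_nonneg_right (add_le_add_left h1 (ε / 4))
      (by nlinarith : (0 : ℝ) ≤ n * (n - 1))
    linarith
  refine hfree ((hcont.of_comap (exists_triangle_completeEquipartiteGraph hr)
    fun i j hij hfij u v hu hv huv => ?_).trans
      (SimpleGraph.IsContained.of_le (balancedSubgraph_le G x K M)))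
  exact (sq_le_of_balancedSubgraph_triangle hK0 hM0 hu hv huv).not_gt (hf i j hij hfij)

theorem theorem1p2 {W : Type*} [Fintype W] (F : SimpleGraph W)
    (r : ℕ) (hr : 3 ≤ r + 1) (hF : F.chromaticNumber = ((r + 1 : ℕ) : ℕ∞))
    (ε : ℝ) (hε : 0 < ε) :
    ∃ m₀ : ℕ, ∀ {V : Type*} [Fintype V] [DecidableEq V] (G : SimpleGraph V)
      [DecidableRel G.Adj], F.Free G → m₀ ≤ G.edgeFinset.card →
        graphSpectralRadius G ^ 2 ≤ (1 - 1 / (r : ℝ) + ε) * (2 * (G.edgeFinset.card : ℝ)) := by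
  classical
  obtain ⟨C⟩ : F.Colorable (r + 1) := SimpleGraph.chromaticNumber_le_iff_colorable.1 hF.le
  -- Colour classes fit into parts of size `Fintype.card W`; the `+ 1` gives `1 ≤ t` with no case
  -- distinction.
  have hcont : F.IsContained
      (SimpleGraph.completeEquipartiteGraph (r + 1) (Fintype.card W + 1)) :=
    SimpleGraph.isContained_completeEquipartiteGraph_of_colorable C _ fun c =>
      (Fintype.card_subtype_le _).trans (Nat.le_succ _)
  obtain ⟨m₀, hm₀⟩ := exists_forall_eigenvalue_sq_le hr (Nat.le_add_left 1 (Fintype.card W)) hε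
  refine ⟨m₀, fun G _ hfree hm => graphSpectralRadius_sq_le G ?_
    (hm₀ G (fun h => hfree (hcont.trans h)) hm)⟩
  have hr2 : (2 : ℝ) ≤ r := by exact_mod_cast (by omega : 2 ≤ r)
  have hrinv : 1 / (r : ℝ) ≤ 1 := by rw [div_le_one (by linarith)]; linarith
  exact mul_nonneg (by linarith) (by positivity)
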